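/- Let $d\ge 1$, let $G\subset\mathbb{R}^d$ be a bounded Borel measurable set, and let $\pi$ be a probability measure on $(G,\mathcal{B}(G))$, where $\mathcal{B}(G)$ is the Borel $\sigma$-algebra of $G$, which is absolutely continuous with respect to the Lebesgue measure (restricted to $G$). Let $$\mathscr{B}=\{(-\infty,x)_G \mid x\in\mathbb{R}^d\},\qquad (-\infty,x)_G=\Big(\prod_{i=1}^d(-\infty,x_i)\Big)\cap G .$$ A finite set $\Gamma_\delta\subseteq\mathcal{B}(G)$ with $\emptyset\in\Gamma_\delta$ is called a $\delta$-cover of $\mathscr{B}$ with respect to $\pi$ if for every $A\in\mathscr{B}$ there are $C,D\in\Gamma_\delta$ such that $C\subseteq A\subseteq D$ and $\pi(D\setminus C)\le\delta$. For $0<\varepsilon<1$ let $$C_{\varepsilon,d}=\max_{x\ge1}\frac{(2+\log_2x)^{(3d+1)/2}}{x^{\varepsilon}}=4^{\varepsilon}\left(\frac{3d+1}{2\mathrm{e}\,\varepsilon\log 2}\right)^{(3d+1)/2},$$ where $\log$ is the natural logarithm (the maximum is attained and has the stated value). Then for all $0<\delta\le1$ and $0<\varepsilon<1$ there is a $\delta$-cover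 $\Gamma_\delta$ of $\mathscr{B}$ with respect to $\pi$ with $$|\Gamma_\delta|\le\left(2+\left\lceil(2C_{\varepsilon,d}\,\delta^{-1})^{1/(1-\varepsilon)}\right\rceil\right)^d .$$ -/

import Mathlib

open MeasureTheory Set

/-- A finite family `Γ` of measurable sets, containing `∅`, is a `δ`-cover of the family `𝒜` of
test sets with respect to `π` if every test set `A` is bracketed by some `C, D ∈ Γ` with
`C ⊆ A ⊆ D` and `π (D \ C) ≤ δ`. -/
structure IsDeltaCover {X : Type*} [MeasurableSpace X] (π : Measure X) (𝒜 : Set (Set X)) (δ : ℝ)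
    (Γ : Finset (Set X)) : Prop where
  measurableSet : ∀ C ∈ Γ, MeasurableSet C
  empty_mem : ∅ ∈ Γ
  exists_bracket : ∀ A ∈ 𝒜, ∃ C ∈ Γ, ∃ D ∈ Γ, C ⊆ A ∧ A ⊆ D ∧ π (D \ C) ≤ ENNReal.ofReal δ

/-- The box `(-∞, x)_G = (∏ i, (-∞, x i)) ∩ G`, as a subset of the state space `G`. -/
def anchoredBox {d : ℕ} (G : Set (Fin d → ℝ)) (x : Fin d → ℝ) : Set G :=
  {y : G | ∀ i, (y : Fin d → ℝ) i < x i}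

/-- The family of all boxes `(-∞, x)_G`, `x ∈ ℝ^d`. -/
def anchoredBoxes {d : ℕ} (G : Set (Fin d → ℝ)) : Set (Set G) :=
  Set.range (anchoredBox G)

/-- The constant `C_{ε,d} = 4^ε ((3d+1) / (2 e ε log 2))^((3d+1)/2)`. -/
noncomputable def coverConst (ε : ℝ) (d : ℕ) : ℝ :=
  (4 : ℝ) ^ ε *
    ((3 * (d : ℝ) + 1) / (2 * Real.exp 1 * ε * Real.log 2)) ^ ((3 * (d : ℝ) + 1) / 2)

/-!
For a probability measure on `ℝ` pick a `j / k`-quantile `t j` for `0 < j < k`. The open interval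
between consecutive quantiles has mass at most `1 / k`, so the rays `(-∞, t j]` from below and
`(-∞, t (j + 1))` from above, completed by `∅` and `ℝ`, bracket every ray `(-∞, x)` up to `1 / k`
with only `2 k` sets. A box is the intersection of `d` such rays, one for each coordinate marginal,
and bracketing errors add up under intersection; hence `(2 k) ^ d` sets achieve the error `d / k`.

Taking `k = ⌈d / δ⌉`, it remains to compare `2 k` with `2 + ⌈(2 C / δ) ^ (1 / (1 - ε))⌉`, where
`C = C_{ε,d}` is the maximum; its value at `x = 1` already gives `C ≥ 2 ^ ((3 d + 1) / 2) ≥ d`.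
-/

section MaximumOfLogPowers

theorem isGreatest_rpow_div_exp {a b c : ℝ} (ha : 0 < a) (hc : 0 < c) (hb : 0 ≤ b)
    (hbac : b ≤ a / c) :
    IsGreatest ((fun t : ℝ => t ^ a / Real.exp (c * t)) '' Ici b)
      ((a / (Real.exp 1 * c)) ^ a) := by
  constructor
  · refine ⟨a / c, hbac, ?_⟩
    calc (a / c) ^ a / Real.exp (c * (a / c))
        = (a / c) ^ a / Real.exp 1 ^ a := by rw [mul_div_cancel₀ a hc.ne', Real.exp_one_rpow]
      _ = (a / (Real.exp 1 * c)) ^ a := by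
        rw [← Real.div_rpow (by positivity) (by positivity), div_div, mul_comm c]
  · rintro _ ⟨t, ht, rfl⟩
    have ht0 : 0 ≤ t := hb.trans ht
    -- In terms of `s = c * t / a` the maximum is at `s = 1`, where `s ≤ exp (s - 1)` is sharp.
    have hexp : c * t / a ≤ Real.exp (c * t / a) / Real.exp 1 := by
      rw [← Real.exp_sub]
      linarith [Real.add_one_le_exp (c * t / a - 1)]
    have hlinear : t ≤ a / (Real.exp 1 * c) * Real.exp (c * t / a) :=
      calc t = a / c * (c * t / a) := by field_simp
        _ ≤ a / c * (Real.exp (c * t / a) / Real.exp 1) := by gcongr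
        _ = a / (Real.exp 1 * c) * Real.exp (c * t / a) := by field_simp
    rw [div_le_iff₀ (Real.exp_pos _)]
    calc t ^ a ≤ (a / (Real.exp 1 * c) * Real.exp (c * t / a)) ^ a :=
          Real.rpow_le_rpow ht0 hlinear ha.le
      _ = (a / (Real.exp 1 * c)) ^ a * Real.exp (c * t) := by
        rw [Real.mul_rpow (by positivity) (Real.exp_pos _).le, ← Real.exp_mul,
          div_mul_cancel₀ _ ha.ne']

lemma image_add_logb_Ici_one {β : ℝ} (hβ : 1 < β) (s : ℝ) :
    (fun x : ℝ => s + Real.logb β x) '' Ici 1 = Ici s := by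
  refine Subset.antisymm ?_ fun t ht => ?_
  · rintro _ ⟨x, hx, rfl⟩
    exact le_add_of_nonneg_right (Real.logb_nonneg hβ hx)
  · refine ⟨β ^ (t - s), Real.one_le_rpow hβ.le (sub_nonneg.2 ht), ?_⟩
    simp only [Real.logb_rpow (by linarith) hβ.ne', add_sub_cancel]

lemma exp_mul_add_logb {β x : ℝ} (hβ0 : 0 < β) (hβ1 : β ≠ 1) (hx : 0 < x) (ε s : ℝ) :
    Real.exp (ε * Real.log β * (s + Real.logb β x)) = (β ^ s) ^ ε * x ^ ε := by
  have hlog : Real.log β ≠ 0 := Real.log_ne_zero_of_pos_of_ne_one hβ0 hβ1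
  rw [← Real.rpow_mul hβ0.le, Real.rpow_def_of_pos hβ0, Real.rpow_def_of_pos hx, ← Real.exp_add,
    Real.logb]
  congr 1
  field_simp

theorem isGreatest_add_logb_rpow_div_rpow {β s a ε : ℝ} (hβ : 1 < β) (hs : 0 ≤ s) (ha : 0 < a)
    (hε : 0 < ε) (hsa : s ≤ a / (ε * Real.log β)) :
    IsGreatest ((fun x : ℝ => (s + Real.logb β x) ^ a / x ^ ε) '' Ici 1)
      ((β ^ s) ^ ε * (a / (Real.exp 1 * (ε * Real.log β))) ^ a) := by
  have hlog : 0 < Real.log β := Real.log_pos hβ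
  have hscale : 0 < (β ^ s) ^ ε :=
    Real.rpow_pos_of_pos (Real.rpow_pos_of_pos (zero_lt_one.trans hβ) s) ε
  have hmax := (monotone_mul_left_of_nonneg hscale.le).map_isGreatest
    (isGreatest_rpow_div_exp ha (mul_pos hε hlog) hs hsa)
  rw [← image_add_logb_Ici_one hβ s, image_image, image_image] at hmax
  have hrescale (x : ℝ) (hx : x ∈ Ici 1) : (s + Real.logb β x) ^ a / x ^ ε = (β ^ s) ^ ε *
      ((s + Real.logb β x) ^ a / Real.exp (ε * Real.log β * (s + Real.logb β x))) := by
    have hx0 : 0 < x := zero_lt_one.trans_le hx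
    rw [exp_mul_add_logb (zero_lt_one.trans hβ) hβ.ne' hx0]
    field_simp
  rwa [image_congr hrescale]

theorem isGreatest_coverConst {d : ℕ} (hd : 1 ≤ d) {ε : ℝ} (hε0 : 0 < ε) (hε1 : ε < 1) :
    IsGreatest
      ((fun x : ℝ => (2 + Real.logb 2 x) ^ ((3 * (d : ℝ) + 1) / 2) / x ^ ε) '' Ici 1)
      (coverConst ε d) := by
  have hd' : (1 : ℝ) ≤ d := by exact_mod_cast hd
  have hargmax : 2 ≤ (3 * (d : ℝ) + 1) / 2 / (ε * Real.log 2) := by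
    rw [le_div_iff₀ (mul_pos hε0 (Real.log_pos one_lt_two))]
    nlinarith [Real.log_two_lt_d9]
  convert isGreatest_add_logb_rpow_div_rpow one_lt_two zero_le_two (by positivity) hε0 hargmax
    using 1
  rw [coverConst, div_div, ← mul_assoc, ← mul_assoc]
  norm_num

lemma natCast_le_coverConst {d : ℕ} (hd : 1 ≤ d) {ε : ℝ} (hε0 : 0 < ε) (hε1 : ε < 1) :
    (d : ℝ) ≤ coverConst ε d := by
  have hvalue_one : (2 : ℝ) ^ ((3 * (d : ℝ) + 1) / 2) ≤ coverConst ε d := by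
    simpa only [Real.logb_one, add_zero, Real.one_rpow, div_one] using
      (isGreatest_coverConst hd hε0 hε1).2 (mem_image_of_mem _ self_mem_Ici)
  calc (d : ℝ) ≤ (2 : ℝ) ^ d := by exact_mod_cast Nat.lt_two_pow_self.le
    _ = (2 : ℝ) ^ (d : ℝ) := (Real.rpow_natCast _ _).symm
    _ ≤ (2 : ℝ) ^ ((3 * (d : ℝ) + 1) / 2) :=
      Real.rpow_le_rpow_of_exponent_le one_le_two (by linarith [Nat.cast_nonneg (α := ℝ) d])
    _ ≤ coverConst ε d := hvalue_one

end MaximumOfLogPowers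

namespace IsDeltaCover

variable {X Y : Type*} [MeasurableSpace X] [MeasurableSpace Y] {π : Measure X}

theorem exists_of_brackets {J : Type*} {s : Finset J} {L U : J → Set X} {𝒜 : Set (Set X)} {δ : ℝ}
    (hL : ∀ j ∈ s, MeasurableSet (L j)) (hU : ∀ j ∈ s, MeasurableSet (U j))
    (hempty : ∃ j ∈ s, L j = ∅)
    (hbracket : ∀ A ∈ 𝒜, ∃ j ∈ s, L j ⊆ A ∧ A ⊆ U j ∧ π (U j \ L j) ≤ ENNReal.ofReal δ) :
    ∃ Γ : Finset (Set X), IsDeltaCover π 𝒜 δ Γ ∧ Γ.card ≤ 2 * s.card := by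
  classical
  refine ⟨s.image L ∪ s.image U, ⟨?_, ?_, fun A hA => ?_⟩, ?_⟩
  · simp only [Finset.mem_union, Finset.mem_image]
    rintro _ (⟨j, hj, rfl⟩ | ⟨j, hj, rfl⟩)
    exacts [hL j hj, hU j hj]
  · exact Finset.mem_union_left _ (Finset.mem_image.2 hempty)
  · obtain ⟨j, hj, hLA, hAU, hmass⟩ := hbracket A hA
    exact ⟨L j, Finset.mem_union_left _ (Finset.mem_image_of_mem L hj),
      U j, Finset.mem_union_right _ (Finset.mem_image_of_mem U hj), hLA, hAU, hmass⟩
  · rw [two_mul]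
    exact (Finset.card_union_le _ _).trans (add_le_add Finset.card_image_le Finset.card_image_le)

theorem preimage [DecidableEq (Set X)] {f : X → Y} (hf : Measurable f) {𝒜 : Set (Set Y)} {δ : ℝ}
    {Γ : Finset (Set Y)} (hΓ : IsDeltaCover (π.map f) 𝒜 δ Γ) :
    IsDeltaCover π ((f ⁻¹' ·) '' 𝒜) δ (Γ.image (f ⁻¹' ·)) where
  measurableSet := Finset.forall_mem_image.2 fun C hC => hf (hΓ.measurableSet C hC)
  empty_mem := Finset.mem_image.2 ⟨∅, hΓ.empty_mem, preimage_empty⟩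
  exists_bracket := by
    rintro _ ⟨A, hA, rfl⟩
    obtain ⟨C, hC, D, hD, hCA, hAD, hmass⟩ := hΓ.exists_bracket A hA
    refine ⟨_, Finset.mem_image_of_mem _ hC, _, Finset.mem_image_of_mem _ hD,
      preimage_mono hCA, preimage_mono hAD, ?_⟩
    rwa [← preimage_sdiff,
      ← Measure.map_apply hf ((hΓ.measurableSet D hD).diff (hΓ.measurableSet C hC))]

theorem iInter [DecidableEq (Set X)] {ι : Type*} [Fintype ι] [DecidableEq ι] [Nonempty ι]
    {𝒜 : ι → Set (Set X)} {δ : ι → ℝ} (hδ : ∀ i, 0 ≤ δ i) {Γ : ι → Finset (Set X)}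
    (hΓ : ∀ i, IsDeltaCover π (𝒜 i) (δ i) (Γ i)) :
    IsDeltaCover π ((fun A : ι → Set X => ⋂ i, A i) '' univ.pi 𝒜) (∑ i, δ i)
      ((Fintype.piFinset Γ).image fun C => ⋂ i, C i) where
  measurableSet := Finset.forall_mem_image.2 fun C hC =>
    MeasurableSet.iInter fun i => (hΓ i).measurableSet (C i) (Fintype.mem_piFinset.1 hC i)
  empty_mem := Finset.mem_image.2
    ⟨fun _ => ∅, Fintype.mem_piFinset.2 fun i => (hΓ i).empty_mem, iInter_const ∅⟩
  exists_bracket := by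
    rintro _ ⟨A, hA, rfl⟩
    choose C hC D hD hCA hAD hmass using fun i => (hΓ i).exists_bracket (A i) (hA i (mem_univ i))
    refine ⟨_, Finset.mem_image_of_mem _ (Fintype.mem_piFinset.2 hC),
      _, Finset.mem_image_of_mem _ (Fintype.mem_piFinset.2 hD),
      iInter_mono hCA, iInter_mono hAD, ?_⟩
    have hdiff : (⋂ i, D i) \ ⋂ i, C i ⊆ ⋃ i, D i \ C i := by
      rintro y ⟨hyD, hyC⟩
      obtain ⟨i, hi⟩ := not_forall.1 (mt mem_iInter.2 hyC)
      exact mem_iUnion.2 ⟨i, mem_iInter.1 hyD i, hi⟩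
    calc π ((⋂ i, D i) \ ⋂ i, C i) ≤ π (⋃ i, D i \ C i) := measure_mono hdiff
      _ ≤ ∑ i, π (D i \ C i) := measure_iUnion_fintype_le π _
      _ ≤ ∑ i, ENNReal.ofReal (δ i) := Finset.sum_le_sum fun i _ => hmass i
      _ = ENNReal.ofReal (∑ i, δ i) := (ENNReal.ofReal_sum_of_nonneg fun i _ => hδ i).symm

theorem of_le {𝒜 : Set (Set X)} {δ δ' : ℝ} {Γ : Finset (Set X)}
    (hΓ : IsDeltaCover π 𝒜 δ Γ) (hδ : δ ≤ δ') : IsDeltaCover π 𝒜 δ' Γ where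
  measurableSet := hΓ.measurableSet
  empty_mem := hΓ.empty_mem
  exists_bracket A hA := by
    obtain ⟨C, hC, D, hD, hCA, hAD, hmass⟩ := hΓ.exists_bracket A hA
    exact ⟨C, hC, D, hD, hCA, hAD, hmass.trans (ENNReal.ofReal_le_ofReal hδ)⟩

end IsDeltaCover

section Rays

variable {α : Type*}

/-- The lower brackets cut out by thresholds `t`: the closed rays, with `∅` for a threshold `-∞` at
index `0`. -/
def lowerRay [Preorder α] (t : ℕ → α) (j : ℕ) : Set α := if j = 0 then ∅ else Iic (t j)

/-- The upper brackets cut out by thresholds `t`: the open rays, with `univ` for a threshold `∞`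
from index `k` on. -/
def upperRay [Preorder α] (t : ℕ → α) (k j : ℕ) : Set α := if j < k then Iio (t j) else univ

lemma measurableSet_lowerRay [Preorder α] [TopologicalSpace α] [ClosedIicTopology α]
    [MeasurableSpace α] [OpensMeasurableSpace α] (t : ℕ → α) (j : ℕ) :
    MeasurableSet (lowerRay t j) := by
  unfold lowerRay
  split_ifs
  exacts [.empty, measurableSet_Iic]

lemma measurableSet_upperRay [LinearOrder α] [TopologicalSpace α] [ClosedIciTopology α]
    [MeasurableSpace α] [OpensMeasurableSpace α] (t : ℕ → α) (k j : ℕ) :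
    MeasurableSet (upperRay t k j) := by
  unfold upperRay
  split_ifs
  exacts [measurableSet_Iio, .univ]

lemma exists_lowerRay_subset_Iio_subset_upperRay [LinearOrder α] (t : ℕ → α) {k : ℕ} (hk : 0 < k)
    (x : α) :
    ∃ j < k, lowerRay t j ⊆ Iio x ∧ Iio x ⊆ upperRay t k (j + 1) := by
  classical
  have hlast : Iio x ⊆ upperRay t k (k - 1 + 1) := by simp [upperRay, Nat.sub_add_cancel hk]
  have hex : ∃ j, Iio x ⊆ upperRay t k (j + 1) := ⟨k - 1, hlast⟩
  have hlt : Nat.find hex < k := (Nat.find_min' hex hlast).trans_lt (Nat.pred_lt hk.ne')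
  refine ⟨Nat.find hex, hlt, ?_, Nat.find_spec hex⟩
  rcases hj : Nat.find hex with _ | i
  · simp [lowerRay]
  · have hnot : ¬ Iio x ⊆ upperRay t k (i + 1) := Nat.find_min hex (by omega)
    rw [upperRay, if_pos (hj ▸ hlt), Iio_subset_Iio_iff, not_le] at hnot
    simpa [lowerRay] using Iic_subset_Iio.2 hnot

end Rays

section Quantiles

/-- `t` is a quantile of level `p` of the measure `μ` on the line: the open ray below `t` has mass
at most `p`, the closed one at least `p`. Both inequalities can be strict when `t` is an atom. -/
structure IsQuantile (μ : Measure ℝ) (p t : ℝ) : Prop where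
  measureReal_Iio_le : μ.real (Iio t) ≤ p
  le_measureReal_Iic : p ≤ μ.real (Iic t)

variable (μ : Measure ℝ) [IsProbabilityMeasure μ]

theorem exists_isQuantile {p : ℝ} (hp0 : 0 < p) (hp1 : p < 1) : ∃ t, IsQuantile μ p t := by
  set F := ProbabilityTheory.cdf μ
  set S : Set ℝ := {s | p ≤ F s}
  have hS_nonempty : S.Nonempty :=
    ((ProbabilityTheory.tendsto_cdf_atTop μ).eventually_const_le hp1).exists
  have hS_bddBelow : BddBelow S := by
    obtain ⟨b, hb⟩ := ((ProbabilityTheory.tendsto_cdf_atBot μ).eventually_lt_const hp0).exists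
    exact ⟨b, fun s hs => (F.mono.reflect_lt (hb.trans_le hs)).le⟩
  refine ⟨sInf S, ?_, ?_⟩
  · have hleftLim : Function.leftLim F (sInf S) ≤ p :=
      le_of_tendsto (F.mono.tendsto_leftLim _) <| eventually_nhdsWithin_of_forall fun s hs =>
        (not_le.1 fun hps => (csInf_le hS_bddBelow hps).not_gt hs).le
    rw [measureReal_def, ← ProbabilityTheory.measure_cdf μ,
      StieltjesFunction.measure_Iio _ (ProbabilityTheory.tendsto_cdf_atBot μ), sub_zero]
    exact ENNReal.toReal_le_of_le_ofReal hp0.le (ENNReal.ofReal_le_ofReal hleftLim)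
  · rw [← ProbabilityTheory.cdf_eq_real, ← StieltjesFunction.iInf_Ioi_eq]
    refine le_ciInf fun r => ?_
    obtain ⟨s, hs, hsr⟩ := exists_lt_of_csInf_lt hS_nonempty r.2
    exact hs.trans (F.mono hsr.le)

theorem exists_isDeltaCover_range_Iio {k : ℕ} (hk : 0 < k) :
    ∃ Γ : Finset (Set ℝ), IsDeltaCover μ (range Iio) (1 / k) Γ ∧ Γ.card ≤ 2 * k := by
  have hk' : (0 : ℝ) < k := by exact_mod_cast hk
  have hquantile (j : ℕ) (hj : 0 < j) (hjk : j < k) : ∃ t, IsQuantile μ (j / k) t :=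
    exists_isQuantile μ (by positivity) ((div_lt_one hk').2 (by exact_mod_cast hjk))
  choose! t ht using hquantile
  have hlower (j : ℕ) (hj : j < k) : j / k ≤ μ.real (lowerRay t j) := by
    rcases Nat.eq_zero_or_pos j with rfl | hj0
    · simp [lowerRay]
    · simpa [lowerRay, hj0.ne'] using (ht j hj0 hj).le_measureReal_Iic
  have hupper (j : ℕ) : μ.real (upperRay t k (j + 1)) ≤ (j + 1) / k := by
    by_cases hj : j + 1 < k
    · simpa [upperRay, hj] using (ht (j + 1) j.succ_pos hj).measureReal_Iio_le
    · simp only [upperRay, hj, if_false, probReal_univ]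
      exact (one_le_div hk').2 (by exact_mod_cast not_lt.1 hj)
  have hbracket : ∀ A ∈ range (Iio : ℝ → Set ℝ), ∃ j ∈ Finset.range k, lowerRay t j ⊆ A ∧
      A ⊆ upperRay t k (j + 1) ∧
        μ (upperRay t k (j + 1) \ lowerRay t j) ≤ ENNReal.ofReal (1 / k) := by
    rintro _ ⟨x, rfl⟩
    obtain ⟨j, hj, hlx, hxu⟩ := exists_lowerRay_subset_Iio_subset_upperRay t hk x
    refine ⟨j, Finset.mem_range.2 hj, hlx, hxu, ?_⟩
    rw [← ofReal_measureReal, measureReal_sdiff (hlx.trans hxu) (measurableSet_lowerRay t j)]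
    refine ENNReal.ofReal_le_ofReal ((sub_le_sub (hupper j) (hlower j hj)).trans_eq ?_)
    ring
  simpa only [Finset.card_range] using IsDeltaCover.exists_of_brackets
    (fun j _ => measurableSet_lowerRay t j) (fun j _ => measurableSet_upperRay t k (j + 1))
    ⟨0, Finset.mem_range.2 hk, if_pos rfl⟩ hbracket

end Quantiles

section Boxes

lemma range_setOf_forall_lt {X ι α : Type*} [Preorder α] (f : ι → X → α) :
    range (fun x : ι → α => {y | ∀ i, f i y < x i}) =
      (fun A : ι → Set X => ⋂ i, A i) '' univ.pi fun i => (f i ⁻¹' ·) '' range Iio := by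
  have hbox (x : ι → α) : {y | ∀ i, f i y < x i} = ⋂ i, f i ⁻¹' Iio (x i) := by ext; simp
  ext B
  constructor
  · rintro ⟨x, rfl⟩
    exact ⟨fun i => f i ⁻¹' Iio (x i), fun i _ => ⟨_, mem_range_self (x i), rfl⟩, (hbox x).symm⟩
  · rintro ⟨A, hA, rfl⟩
    simp only [mem_univ_pi, mem_image, exists_range_iff] at hA
    choose x hx using hA
    exact ⟨x, by simp only [hbox, hx]⟩

theorem exists_isDeltaCover_range_setOf_forall_lt {X ι : Type*} [MeasurableSpace X] [Fintype ι]
    [Nonempty ι] (π : Measure X) [IsProbabilityMeasure π] {f : ι → X → ℝ}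
    (hf : ∀ i, Measurable (f i)) {k : ℕ} (hk : 0 < k) :
    ∃ Γ : Finset (Set X),
      IsDeltaCover π (range fun x : ι → ℝ => {y | ∀ i, f i y < x i}) (Fintype.card ι / k) Γ ∧
        Γ.card ≤ (2 * k) ^ Fintype.card ι := by
  classical
  have hmarginal (i : ι) : ∃ Γ : Finset (Set ℝ),
      IsDeltaCover (π.map (f i)) (range Iio) (1 / k) Γ ∧ Γ.card ≤ 2 * k :=
    have := Measure.isProbabilityMeasure_map (μ := π) (hf i).aemeasurable
    exists_isDeltaCover_range_Iio (π.map (f i)) hk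
  choose Γ hΓ hcard using hmarginal
  have hcover := IsDeltaCover.iInter (fun _ => by positivity) fun i => (hΓ i).preimage (hf i)
  rw [← range_setOf_forall_lt, Finset.sum_const, Finset.card_univ, nsmul_eq_mul, mul_one_div]
    at hcover
  refine ⟨_, hcover, Finset.card_image_le.trans ?_⟩
  rw [Fintype.card_piFinset]
  exact Finset.prod_le_pow_card _ _ _ fun i _ => Finset.card_image_le.trans (hcard i)

lemma two_mul_ceil_le_two_add_ceil_rpow {u v p : ℝ} (huv : 2 * u ≤ v) (hp : 1 ≤ p) :
    2 * ⌈u⌉₊ ≤ 2 + ⌈v ^ p⌉₊ := by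
  rcases le_or_gt u 1 with hu | hu
  · have : ⌈u⌉₊ ≤ 1 := Nat.ceil_le.2 (by exact_mod_cast hu)
    omega
  · have hceil : (⌈u⌉₊ : ℝ) < u + 1 := Nat.ceil_lt_add_one (by linarith)
    have hpow : v ≤ ⌈v ^ p⌉₊ :=
      (Real.self_le_rpow_of_one_le (by linarith) hp).trans (Nat.le_ceil _)
    have : (2 * ⌈u⌉₊ : ℝ) ≤ 2 + ⌈v ^ p⌉₊ := by linarith
    exact_mod_cast this

theorem mainTheorem8_general {d : ℕ} (hd : 1 ≤ d) (G : Set (Fin d → ℝ)) (π : Measure G)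
    [IsProbabilityMeasure π] {δ : ℝ} (hδ : 0 < δ) {ε : ℝ} (hε0 : 0 < ε) (hε1 : ε < 1) :
    IsGreatest
        ((fun x : ℝ => (2 + Real.logb 2 x) ^ ((3 * (d : ℝ) + 1) / 2) / x ^ ε) '' Ici 1)
        (coverConst ε d) ∧
      ∃ Γ : Finset (Set G), IsDeltaCover π (anchoredBoxes G) δ Γ ∧
        Γ.card ≤ (2 + ⌈(2 * coverConst ε d * δ⁻¹) ^ (1 / (1 - ε))⌉₊) ^ d := by
  refine ⟨isGreatest_coverConst hd hε0 hε1, ?_⟩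
  have : Nonempty (Fin d) := ⟨⟨0, hd⟩⟩
  have hd' : (0 : ℝ) < d := by exact_mod_cast hd
  have hk : 0 < ⌈d / δ⌉₊ := Nat.ceil_pos.2 (div_pos hd' hδ)
  obtain ⟨Γ, hΓ, hcard⟩ := exists_isDeltaCover_range_setOf_forall_lt π
    (fun i => (measurable_pi_apply i).comp (measurable_subtype_coe (p := (· ∈ G)))) hk
  rw [Fintype.card_fin] at hΓ hcard
  have herror : (d : ℝ) / ⌈d / δ⌉₊ ≤ δ := by
    rw [div_le_comm₀ (by exact_mod_cast hk) hδ]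
    exact Nat.le_ceil _
  have hbase : 2 * (d / δ) ≤ 2 * coverConst ε d * δ⁻¹ := by
    rw [div_eq_mul_inv, ← mul_assoc]
    gcongr
    exact natCast_le_coverConst hd hε0 hε1
  have hexponent : 1 ≤ 1 / (1 - ε) := (one_le_div (by linarith)).2 (by linarith)
  exact ⟨Γ, hΓ.of_le herror,
    hcard.trans (Nat.pow_le_pow_left (two_mul_ceil_le_two_add_ceil_rpow hbase hexponent) d)⟩

end Boxes

theorem mainTheorem8 (d : ℕ) (hd : 1 ≤ d) (G : Set (Fin d → ℝ)) (hGb : Bornology.IsBounded G)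
    (hGm : MeasurableSet G) (π : Measure G) [IsProbabilityMeasure π]
    (hπ : π ≪ (volume : Measure (Fin d → ℝ)).comap (Subtype.val : G → (Fin d → ℝ)))
    (δ : ℝ) (hδ0 : 0 < δ) (hδ1 : δ ≤ 1) (ε : ℝ) (hε0 : 0 < ε) (hε1 : ε < 1) :
    IsGreatest
        ((fun x : ℝ => (2 + Real.logb 2 x) ^ ((3 * (d : ℝ) + 1) / 2) / x ^ ε) '' Set.Ici 1)
        (coverConst ε d) ∧
      ∃ Γ : Finset (Set G), IsDeltaCover π (anchoredBoxes G) δ Γ ∧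
        Γ.card ≤ (2 + ⌈(2 * coverConst ε d * δ⁻¹) ^ (1 / (1 - ε))⌉₊) ^ d :=
  mainTheorem8_general hd G π hδ0 hε0 hε1
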